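/- An MV-algebra is an algebra $\langle A,\oplus,\neg,0\rangle$ of type $(2,1,0)$ such that $\oplus$ is associative and commutative with neutral element $0$, $\neg\neg x=x$, $x\oplus\neg 0=\neg 0$, and $\neg(\neg x\oplus y)\oplus y=\neg(\neg y\oplus x)\oplus x$. Let $\mathcal{MV}_f$ be the class of finite MV-algebras with $0\neq\neg 0$; a Fraïssé limit of $\mathcal{MV}_f$ is a countable ultrahomogeneous structure in the signature $(\oplus,\neg,0)$ whose age (the class of finitely generated structures embeddable in it) is $\mathcal{MV}_f$. Let $B_\infty$ be the countable atomless Boolean algebra with $0\ne1$ (unique up to isomorphism). The Boolean center of an MV-algebra $M$ is its subalgebra $\operatorname{B}(M)=\{x\in M: x\oplus x=x\}$. Let $C\subseteq\mathbb{R}$ be the Cantor set with the usual topology and let $A$ be the subalgebra of $[0,1]^C$ (with pointwise operations $x\oplus y=\min(x+y,1)$, $\neg x=1-x$) consisting of all finite joins of functions $\overline q_U$, where $q\in[0,1]\cap\mathbb{Q}$, $U\subseteq C$ is clopen, and $\overline q_U$ is equal to $q$ on $U$ and to $0$ off $U$. Then: 1. $A$ is a Fraïssé limit of $\mathcal{MV}_f$,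 and $h\mapsto(f\mapsto f\circ h^{-1})$ is a group isomorphism from the group of self-homeomorphisms of $C$ onto $\operatorname{Aut}(A)$. 2. For every Fraïssé limit $M$ of $\mathcal{MV}_f$, $\operatorname{Aut}(M)\cong\operatorname{Aut}(B_\infty)$ as groups. Moreover, $M$ is an MV-algebra, restriction $\sigma\mapsto\sigma|_{\operatorname{B}(M)}$ is a group isomorphism $\operatorname{Aut}(M)\to\operatorname{Aut}(\operatorname{B}(M))$, and $\operatorname{B}(M)$ is isomorphic to $B_\infty$ (with $\oplus,\neg,0$ corresponding to join, complement and $0$). -/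

import Mathlib

open FirstOrder FirstOrder.Language

universe u v

/-- Function symbols of the signature `(⊕, ¬, 0)` of type `(2, 1, 0)`. -/
inductive MVFunc : ℕ → Type
  | zero : MVFunc 0
  | neg : MVFunc 1
  | oplus : MVFunc 2

/-- The first-order signature of MV-algebras; there are no relation symbols. -/
def mvLang : FirstOrder.Language.{0, 0} := ⟨MVFunc, fun _ => Empty⟩

instance : Countable (Σ n, mvLang.Functions n) := by
  refine Function.Injective.countable (β := ℕ) (f := fun s => s.1) ?_
  rintro ⟨m, f⟩ ⟨n, g⟩ h
  obtain rfl : m = n := h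
  change MVFunc m at f g
  cases f <;> cases g <;> rfl

/-- The `mvLang`-structure given by a constant, a unary and a binary operation. -/
@[reducible] def mvStructure {M : Type u} (z : M) (neg : M → M) (add : M → M → M) :
    mvLang.Structure M where
  funMap := fun {n} f =>
    match n, (f : MVFunc n) with
    | _, .zero => fun _ => z
    | _, .neg => fun x => neg (x 0)
    | _, .oplus => fun x => add (x 0) (x 1)
  RelMap := fun r => Empty.elim r

section Operations

variable {M : Type u} [mvLang.Structure M]

variable (M) in
/-- The constant `0`. -/
def mvZero : M := Structure.funMap (L := mvLang) MVFunc.zero ![]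

/-- The negation `¬ x`. -/
def mvNeg (x : M) : M := Structure.funMap (L := mvLang) MVFunc.neg ![x]

/-- The Łukasiewicz sum `x ⊕ y`. -/
def mvAdd (x y : M) : M := Structure.funMap (L := mvLang) MVFunc.oplus ![x, y]

end Operations

/-- The equations defining MV-algebras. -/
structure IsMVAlgebra (M : Type u) [mvLang.Structure M] : Prop where
  add_assoc : ∀ x y z : M, mvAdd x (mvAdd y z) = mvAdd (mvAdd x y) z
  add_comm : ∀ x y : M, mvAdd x y = mvAdd y x
  add_zero : ∀ x : M, mvAdd x (mvZero M) = x
  neg_neg : ∀ x : M, mvNeg (mvNeg x) = x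
  add_neg_zero : ∀ x : M, mvAdd x (mvNeg (mvZero M)) = mvNeg (mvZero M)
  lukasiewicz : ∀ x y : M,
    mvAdd (mvNeg (mvAdd (mvNeg x) y)) y = mvAdd (mvNeg (mvAdd (mvNeg y) x)) x

/-- The class of finite (nontrivial, that is, `0 ≠ 1`) MV-algebras. -/
def finiteMV : Set (CategoryTheory.Bundled.{u} mvLang.Structure) :=
  {S | IsMVAlgebra S ∧ Finite S ∧ Nontrivial S}

/-- The automorphism group of a first-order structure, under composition. -/
instance autGroup (L : FirstOrder.Language.{0, 0}) (M : Type u) [L.Structure M] : Group (M ≃[L] M) where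
  mul f g := f.comp g
  one := FirstOrder.Language.Equiv.refl L M
  inv f := f.symm
  mul_assoc _ _ _ := rfl
  one_mul _ := rfl
  mul_one _ := rfl
  inv_mul_cancel f := by
    apply FirstOrder.Language.Equiv.ext
    intro x
    exact f.symm_apply_apply x

/-! ### The Boolean center -/

theorem IsMVAlgebra.neg_idem {M : Type u} [mvLang.Structure M] (hM : IsMVAlgebra M) {x : M}
    (hx : mvAdd x x = x) : mvAdd (mvNeg x) (mvNeg x) = mvNeg x := by
  have em : ∀ a : M, mvAdd (mvNeg a) a = mvNeg (mvZero M) := by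
    intro a
    have h := hM.lukasiewicz a (mvNeg (mvZero M))
    rw [hM.add_neg_zero, hM.neg_neg, hM.add_comm (mvZero M) a, hM.add_zero] at h
    exact h.symm
  have anti : ∀ a b : M, mvAdd (mvNeg a) b = mvNeg (mvZero M) →
      mvAdd (mvNeg b) a = mvNeg (mvZero M) → a = b := by
    intro a b h1 h2
    have h := hM.lukasiewicz a b
    rw [h1, h2, hM.neg_neg, hM.add_comm _ b, hM.add_comm _ a, hM.add_zero, hM.add_zero] at h
    exact h.symm
  apply anti
  · have h := hM.lukasiewicz x (mvNeg x)
    rw [hM.neg_neg, hx, em] at h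
    exact h
  · rw [hM.neg_neg, hM.add_assoc, hM.add_comm x, em, hM.add_comm, hM.add_neg_zero]

/-- The Boolean center of an MV-algebra: the subalgebra of its idempotent elements. -/
def booleanCenter {M : Type u} [mvLang.Structure M] (hM : IsMVAlgebra M) :
    mvLang.Substructure M where
  carrier := {x | mvAdd x x = x}
  fun_mem := by
    intro n f xs hxs
    change MVFunc n at f
    cases f with
    | zero =>
      have h : (Structure.funMap (L := mvLang) MVFunc.zero xs : M) = mvZero M :=
        congrArg _ (Subsingleton.elim _ _)
      change mvAdd (Structure.funMap (L := mvLang) MVFunc.zero xs : M) _ = _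
      rw [h]
      exact hM.add_zero _
    | neg =>
      have h : (Structure.funMap (L := mvLang) MVFunc.neg xs : M) = mvNeg (xs 0) :=
        congrArg _ (by ext i; fin_cases i; rfl)
      change mvAdd (Structure.funMap (L := mvLang) MVFunc.neg xs : M) _ = _
      rw [h]
      exact hM.neg_idem (hxs 0)
    | oplus =>
      have h : (Structure.funMap (L := mvLang) MVFunc.oplus xs : M) = mvAdd (xs 0) (xs 1) :=
        congrArg _ (by ext i; fin_cases i <;> rfl)
      change mvAdd (Structure.funMap (L := mvLang) MVFunc.oplus xs : M) _ = _
      rw [h]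
      have h0 : mvAdd (xs 0) (xs 0) = xs 0 := hxs 0
      have h1 : mvAdd (xs 1) (xs 1) = xs 1 := hxs 1
      calc mvAdd (mvAdd (xs 0) (xs 1)) (mvAdd (xs 0) (xs 1))
          = mvAdd (mvAdd (xs 0) (xs 0)) (mvAdd (xs 1) (xs 1)) := by
            rw [← hM.add_assoc, hM.add_assoc (xs 1), hM.add_comm (xs 1) (xs 0),
              ← hM.add_assoc (xs 0) (xs 1), hM.add_assoc]
        _ = _ := by rw [h0, h1]

/-! ### Rational-valued fuzzy clopens of the Cantor set -/

/-- The MV-algebra `[0,1]^X` of fuzzy subsets of `X`: pointwise `min (x + y) 1` and `1 - x`. -/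
instance fuzzyStructure (X : Type u) : mvLang.Structure (X → unitInterval) :=
  mvStructure (fun _ => 0) (fun f x => unitInterval.symm (f x))
    (fun f g x => ⟨min ((f x : ℝ) + g x) 1,
      le_min (add_nonneg (f x).2.1 (g x).2.1) zero_le_one, min_le_right _ _⟩)

/-- The fuzzy set with value `q` on `U` and `0` outside `U`. -/
noncomputable def fuzzyConst (q : unitInterval) (U : Set cantorSet) : cantorSet → unitInterval :=
  U.indicator fun _ => q

/-- Finite joins of fuzzy sets `fuzzyConst q U` with `q` rational and `U` a clopen subset of the
Cantor set. -/
def rationalFuzzyClopens : Set (cantorSet → unitInterval) :=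
  {f | ∃ (n : ℕ) (q : Fin n → unitInterval) (U : Fin n → Set cantorSet),
    (∀ i, ∃ r : ℚ, (q i : ℝ) = r) ∧ (∀ i, IsClopen (U i)) ∧
    f = Finset.univ.sup fun i => fuzzyConst (q i) (U i)}

theorem mem_rationalFuzzyClopens_iff (f : cantorSet → unitInterval) :
    f ∈ rationalFuzzyClopens ↔ IsLocallyConstant f ∧ ∀ x, ∃ r : ℚ, (f x : ℝ) = r := by
  constructor
  · rintro ⟨n, q, U, hq, hU, rfl⟩
    refine Finset.sup_induction (p := fun f : cantorSet → unitInterval =>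
      IsLocallyConstant f ∧ ∀ x, ∃ r : ℚ, (f x : ℝ) = r) ?_ ?_ ?_
    · exact ⟨IsLocallyConstant.const _, fun x => ⟨0, by simp⟩⟩
    · rintro f ⟨hf, hf'⟩ g ⟨hg, hg'⟩
      refine ⟨hf.comp₂ hg (· ⊔ ·), fun x => ?_⟩
      rcases le_total (f x) (g x) with h | h
      · simpa [h] using hg' x
      · simpa [h] using hf' x
    · intro i _
      constructor
      · rw [IsLocallyConstant.iff_exists_open]
        intro x
        by_cases hx : x ∈ U i
        · exact ⟨U i, (hU i).isOpen, hx, fun y hy => by simp [fuzzyConst, hx, hy]⟩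
        · exact ⟨(U i)ᶜ, (hU i).compl.isOpen, hx, fun y hy => by
            have : y ∉ U i := hy
            simp [fuzzyConst, hx, this]⟩
      · intro x
        by_cases hx : x ∈ U i
        · simpa [fuzzyConst, hx] using hq i
        · exact ⟨0, by simp [fuzzyConst, hx]⟩
  · rintro ⟨hf, hq⟩
    have : CompactSpace cantorSet := isCompact_iff_compactSpace.mp isCompact_cantorSet
    have hfin : (Set.range f).Finite := hf.range_finite
    let _ := hfin.fintype
    let e := Fintype.equivFin (Set.range f)
    refine ⟨_, fun i => (e.symm i : unitInterval), fun i => f ⁻¹' {(e.symm i : unitInterval)},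
      fun i => ?_, fun i => hf.isClopen_fiber _, ?_⟩
    · obtain ⟨x, hx⟩ := (e.symm i).2
      obtain ⟨r, hr⟩ := hq x
      exact ⟨r, by rw [← hr, hx]⟩
    · funext x
      apply le_antisymm
      · rw [Finset.sup_apply]
        refine le_trans ?_ (Finset.le_sup (Finset.mem_univ (e ⟨f x, x, rfl⟩)))
        simp [fuzzyConst]
      · rw [Finset.sup_apply]
        refine Finset.sup_le fun i _ => ?_
        by_cases h : f x = (e.symm i : unitInterval)
        · simp [fuzzyConst, h]
        · simp [fuzzyConst, h]

/-- The MV-algebra `A` of rational-valued fuzzy clopens of the Cantor set, as a subalgebra of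
`[0,1]^C`. -/
def cantorMV : mvLang.Substructure (cantorSet → unitInterval) where
  carrier := rationalFuzzyClopens
  fun_mem := by
    intro n f xs hxs
    change MVFunc n at f
    simp only [mem_rationalFuzzyClopens_iff] at hxs ⊢
    cases f with
    | zero => exact ⟨IsLocallyConstant.const _, fun x => ⟨0, by simp [Structure.funMap]⟩⟩
    | neg =>
      refine ⟨(hxs 0).1.comp unitInterval.symm, fun x => ?_⟩
      obtain ⟨r, hr⟩ := (hxs 0).2 x
      exact ⟨1 - r, by simp [Structure.funMap, hr]⟩
    | oplus =>
      refine ⟨(hxs 0).1.comp₂ (hxs 1).1 (fun a b : unitInterval =>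
        (⟨min ((a : ℝ) + b) 1, le_min (add_nonneg a.2.1 b.2.1) zero_le_one,
          min_le_right _ _⟩ : unitInterval)), fun x => ?_⟩
      obtain ⟨r, hr⟩ := (hxs 0).2 x
      obtain ⟨s, hs⟩ := (hxs 1).2 x
      exact ⟨min (r + s) 1, by simp [Structure.funMap, hr, hs]⟩

instance : Countable cantorMV := by
  have : CompactSpace cantorSet := isCompact_iff_compactSpace.mp isCompact_cantorSet
  have : Countable (TopologicalSpace.Clopens cantorSet) :=
    have : TotallyDisconnectedSpace cantorSet :=
      cantorSetHomeomorphNatToBool.symm.totallyDisconnectedSpace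
    TopologicalSpace.Clopens.countable_iff_secondCountable.mpr inferInstance
  let Q := {q : unitInterval // ∃ r : ℚ, (q : ℝ) = r}
  have : Countable Q := by
    choose r hr using fun q : Q => q.2
    refine Function.Injective.countable (f := r) fun a b h => ?_
    exact Subtype.ext (Subtype.ext ((hr a).trans (h ▸ (hr b).symm)))
  have h : rationalFuzzyClopens ⊆ Set.range
      (fun p : Σ n, (Fin n → Q) × (Fin n → TopologicalSpace.Clopens cantorSet) =>
        Finset.univ.sup fun i => fuzzyConst (p.2.1 i).1 (p.2.2 i)) := by
    rintro f ⟨n, q, U, hq, hU, rfl⟩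
    exact ⟨⟨n, fun i => ⟨q i, hq i⟩, fun i => ⟨U i, hU i⟩⟩, rfl⟩
  exact ((Set.countable_range _).mono h).to_subtype

/-!
Let `S` be the algebra of all rational-valued locally constant functions on a compact, totally
separated space `X` without isolated points. By compactness the characters `R → [0,1]` of a
subalgebra `R` are evaluations at points of `X`, so an embedding of a finite MV-algebra `T` into
`S` amounts to a locally constant surjection of `X` onto a finite set of characters separating the
points of `T`. As `X` has no isolated points, such surjections lift along surjections of finite
sets; this is the extension property of `S`, from which ultrahomogeneity, universality and, by
back-and-forth, uniqueness follow. Moreover `X` is the space of characters of `S`, so automorphisms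
of `S` are homeomorphisms of `X`. The Boolean center of `S` consists of the `{0, 1}`-valued
functions on the same space, and by Stone duality the countable atomless Boolean algebra has a
representation of that kind too.
-/

/-! ### Atoms and their multiples in MV-algebras -/

/-- MV-algebras in additive notation, with `x + y` for `x ⊕ y` and `xᶜ` for `¬ x`. This is the
form in which their order theory is developed; `IsMVAlgebra.toMVAlgebra` passes to it from the
first-order signature. -/
class MVAlgebra (M : Type*) extends AddCommMonoid M, Compl M where
  protected compl_compl : ∀ x : M, xᶜᶜ = x
  add_compl_zero : ∀ x : M, x + 0ᶜ = 0ᶜ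
  lukasiewicz : ∀ x y : M, (xᶜ + y)ᶜ + y = (yᶜ + x)ᶜ + x

namespace MVAlgebra

variable {M : Type*} [MVAlgebra M]

theorem compl_add_self (x : M) : xᶜ + x = 0ᶜ := by
  simpa only [add_compl_zero, MVAlgebra.compl_compl, zero_add] using (lukasiewicz x 0ᶜ).symm

theorem compl_add_eq_compl_zero_iff {x y : M} : xᶜ + y = 0ᶜ ↔ ∃ z, x + z = y := by
  constructor
  · intro h
    exact ⟨(yᶜ + x)ᶜ, by rw [add_comm, ← lukasiewicz, h, MVAlgebra.compl_compl, zero_add]⟩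
  · rintro ⟨z, rfl⟩
    rw [← add_assoc, compl_add_self, add_comm, add_compl_zero]

instance : PartialOrder M where
  le x y := xᶜ + y = 0ᶜ
  le_refl := compl_add_self
  le_trans x y z hxy hyz := by
    obtain ⟨a, rfl⟩ := compl_add_eq_compl_zero_iff.1 hxy
    obtain ⟨b, rfl⟩ := compl_add_eq_compl_zero_iff.1 hyz
    exact compl_add_eq_compl_zero_iff.2 ⟨a + b, (add_assoc _ _ _).symm⟩
  le_antisymm x y hxy hyx := by
    simpa only [hxy, hyx, MVAlgebra.compl_compl, zero_add] using (lukasiewicz x y).symm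

theorem le_iff_compl_add_eq {x y : M} : x ≤ y ↔ xᶜ + y = 0ᶜ := Iff.rfl

instance : IsOrderedAddMonoid M where
  add_le_add_left x y h z := by
    obtain ⟨w, rfl⟩ := compl_add_eq_compl_zero_iff.1 h
    exact compl_add_eq_compl_zero_iff.2 ⟨w, add_right_comm _ _ _⟩

instance : CanonicallyOrderedAdd M where
  exists_add_of_le h := (compl_add_eq_compl_zero_iff.1 h).imp fun _ hz => hz.symm
  le_add_self x y := compl_add_eq_compl_zero_iff.2 ⟨y, add_comm x y⟩
  le_self_add _ y := compl_add_eq_compl_zero_iff.2 ⟨y, rfl⟩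

instance : OrderBot M := IsBotZeroClass.toOrderBot M

theorem le_compl_zero (x : M) : x ≤ 0ᶜ := add_compl_zero xᶜ

instance : Sub M := ⟨fun x y => (xᶜ + y)ᶜ⟩

theorem tsub_def (x y : M) : x - y = (xᶜ + y)ᶜ := rfl

instance : OrderedSub M where
  tsub_le_iff_right x y z := by
    rw [le_iff_compl_add_eq, le_iff_compl_add_eq, tsub_def, MVAlgebra.compl_compl, add_assoc,
      add_comm y]

theorem compl_le_compl_iff {x y : M} : xᶜ ≤ yᶜ ↔ y ≤ x := by
  rw [le_iff_compl_add_eq, le_iff_compl_add_eq, MVAlgebra.compl_compl, add_comm]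

theorem compl_tsub (x y : M) : xᶜ - y = (x + y)ᶜ := by
  rw [tsub_def, MVAlgebra.compl_compl]

theorem add_tsub_cancel_of_le_compl {x y : M} (h : x ≤ yᶜ) : x + y - y = x := by
  have key := lukasiewicz xᶜ y
  rw [MVAlgebra.compl_compl, add_comm yᶜ, le_iff_compl_add_eq.1 h, MVAlgebra.compl_compl,
    zero_add] at key
  rw [tsub_def, key, MVAlgebra.compl_compl]

theorem le_or_le_of_le_add {a x y : M} (ha : IsAtom a) (h : a ≤ x + y) : a ≤ x ∨ a ≤ y := by
  rcases ha.le_iff.1 (tsub_le_self : a - y ≤ a) with hbot | heq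
  · exact Or.inr (tsub_eq_zero_iff_le.1 (hbot.trans bot_eq_zero))
  · exact Or.inl (heq ▸ tsub_le_iff_right.2 h)

theorem add_tsub_cancel_of_isAtom {a x : M} (ha : IsAtom a) (h : a + x ≠ x) : a + x - x = a := by
  refine (ha.le_iff.1 (tsub_le_iff_right.2 le_rfl)).resolve_left fun hbot => h ?_
  exact le_antisymm (tsub_eq_zero_iff_le.1 (hbot.trans bot_eq_zero)) le_add_self

theorem not_le_compl_of_add_eq {a x : M} (ha : IsAtom a) (h : a + x = x) : ¬ a ≤ xᶜ := by
  intro hle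
  have hsub := add_tsub_cancel_of_le_compl hle
  rw [h, tsub_eq_zero_iff_le.2 le_rfl] at hsub
  exact ha.ne_bot (hsub.symm.trans bot_eq_zero.symm)

section Multiples

variable [Finite M]

theorem exists_add_nsmul_eq (a : M) : ∃ n : ℕ, a + n • a = n • a := by
  by_contra! h
  refine not_injective_infinite_finite (fun n : ℕ => n • a)
    (strictMono_nat_of_lt_succ fun n => ?_).injective
  rw [succ_nsmul']
  exact lt_of_le_of_ne le_add_self (h n).symm

open Classical in
/-- The least `n` with `(n + 1) • a = n • a`; for an atom `a` the multiples of `a` form the chain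
`0 < a < ⋯ < order a • a`. -/
noncomputable def order (a : M) : ℕ := Nat.find (exists_add_nsmul_eq a)

open Classical in
/-- The multiplicity of `a` in `y`: the largest `k ≤ order a` with `k • a ≤ y`. -/
noncomputable def coeff (a y : M) : ℕ := Nat.findGreatest (fun k => k • a ≤ y) (order a)

theorem add_order_nsmul (a : M) : a + order a • a = order a • a := by
  classical exact Nat.find_spec (exists_add_nsmul_eq a)

theorem add_nsmul_ne {a : M} {k : ℕ} (h : k < order a) : a + k • a ≠ k • a := by
  classical exact Nat.find_min (exists_add_nsmul_eq a) h

theorem nsmul_eq_of_order_le (a : M) {k : ℕ} (h : order a ≤ k) : k • a = order a • a := by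
  induction k, h using Nat.le_induction with
  | base => rfl
  | succ k _ ih => rw [succ_nsmul', ih, add_order_nsmul]

theorem coeff_le_order (a y : M) : coeff a y ≤ order a := by
  classical exact Nat.findGreatest_le _

theorem coeff_nsmul_le (a y : M) : coeff a y • a ≤ y := by
  classical
  exact Nat.findGreatest_spec (P := fun k => k • a ≤ y) (Nat.zero_le _)
    (by simp only [zero_nsmul, zero_le])

theorem le_coeff {a y : M} {k : ℕ} (hk : k ≤ order a) (h : k • a ≤ y) : k ≤ coeff a y := by
  classical exact Nat.le_findGreatest hk h

theorem coeff_compl_zero (a : M) : coeff a 0ᶜ = order a :=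
  le_antisymm (coeff_le_order _ _) (le_coeff le_rfl (le_compl_zero _))

variable {a : M} (ha : IsAtom a)
include ha

theorem order_pos : 0 < order a := by
  refine Nat.pos_of_ne_zero fun h => ha.ne_bot ?_
  simpa only [h, zero_nsmul, add_zero, bot_eq_zero] using add_order_nsmul a

theorem succ_nsmul_tsub_nsmul {k : ℕ} (h : k < order a) : (k + 1) • a - k • a = a := by
  rw [succ_nsmul']
  exact add_tsub_cancel_of_isAtom ha (add_nsmul_ne h)

theorem not_le_tsub_coeff_nsmul (y : M) : ¬ a ≤ y - coeff a y • a := by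
  intro h
  rcases (coeff_le_order a y).lt_or_eq with hlt | heq
  · have hsucc := add_le_add_left h (coeff a y • a)
    rw [tsub_add_cancel_of_le (coeff_nsmul_le a y), ← succ_nsmul'] at hsucc
    exact (le_coeff hlt hsucc).not_gt (Nat.lt_succ_self _)
  · rw [heq] at h
    refine not_le_compl_of_add_eq ha (add_order_nsmul a) (h.trans ?_)
    calc y - order a • a ≤ 0ᶜ - order a • a := tsub_le_tsub_right (le_compl_zero y) _
      _ = (order a • a)ᶜ := by rw [compl_tsub, zero_add]

theorem exists_eq_coeff_nsmul_add (y : M) : ∃ r, ¬ a ≤ r ∧ y = coeff a y • a + r :=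
  ⟨_, not_le_tsub_coeff_nsmul ha y, (add_tsub_cancel_of_le (coeff_nsmul_le a y)).symm⟩

theorem le_of_nsmul_le_nsmul_add {k l : ℕ} {r : M} (hr : ¬ a ≤ r) (hl : l ≤ order a)
    (h : l • a ≤ k • a + r) : l ≤ k := by
  by_contra! hlt
  have hsucc : (k + 1) • a ≤ r + k • a := by
    rw [add_comm r]
    exact (nsmul_le_nsmul_left zero_le hlt).trans h
  rw [← tsub_le_iff_right, succ_nsmul_tsub_nsmul ha (hlt.trans_le hl)] at hsucc
  exact hr hsucc

theorem coeff_nsmul_add {k : ℕ} {r : M} (hr : ¬ a ≤ r) :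
    coeff a (k • a + r) = min k (order a) := by
  refine le_antisymm (le_min ?_ (coeff_le_order _ _)) (le_coeff (min_le_right _ _) ?_)
  · exact le_of_nsmul_le_nsmul_add ha hr (coeff_le_order _ _) (coeff_nsmul_le _ _)
  · exact (nsmul_le_nsmul_left zero_le (min_le_left _ _)).trans le_self_add

theorem coeff_zero : coeff a 0 = 0 := by
  have h := coeff_nsmul_add ha (k := 0) (r := 0) fun h =>
    ha.ne_bot (bot_eq_zero (α := M) ▸ le_zero_iff.1 h)
  simpa only [zero_nsmul, add_zero, Nat.zero_min] using h

theorem coeff_add (y z : M) : coeff a (y + z) = min (coeff a y + coeff a z) (order a) := by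
  obtain ⟨r, hr, hy⟩ := exists_eq_coeff_nsmul_add ha y
  obtain ⟨s, hs, hz⟩ := exists_eq_coeff_nsmul_add ha z
  have hrs : ¬ a ≤ r + s := fun h => (le_or_le_of_le_add ha h).elim hr hs
  rw [← coeff_nsmul_add ha hrs, add_nsmul, add_add_add_comm, ← hy, ← hz]

theorem coeff_compl_add_coeff_le (y : M) : coeff a yᶜ + coeff a y ≤ order a := by
  by_contra! hlt
  obtain ⟨j, hj⟩ : ∃ j, coeff a y = j + 1 :=
    Nat.exists_eq_succ_of_ne_zero (by have := coeff_le_order a yᶜ; lia)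
  have hy := coeff_nsmul_le a y
  have hcompl : y ≤ (coeff a yᶜ • a)ᶜ := by
    rw [← compl_le_compl_iff, MVAlgebra.compl_compl]
    exact coeff_nsmul_le a yᶜ
  rw [hj] at hy
  have hle := tsub_le_tsub_right (hy.trans hcompl) (j • a)
  rw [succ_nsmul_tsub_nsmul ha (by have := coeff_le_order a y; lia), compl_tsub, ← add_nsmul,
    nsmul_eq_of_order_le a (by lia)] at hle
  exact not_le_compl_of_add_eq ha (add_order_nsmul a) hle

theorem coeff_compl (y : M) : coeff a yᶜ + coeff a y = order a := by
  have h := coeff_add ha yᶜ y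
  rw [compl_add_self, coeff_compl_zero] at h
  exact (coeff_compl_add_coeff_le ha y).antisymm (by lia)

theorem coeff_pos {y : M} (h : a ≤ y) : 0 < coeff a y :=
  le_coeff (order_pos ha) (by rwa [one_nsmul])

end Multiples

end MVAlgebra

section Homomorphisms

variable {M N : Type*} [mvLang.Structure M] [mvLang.Structure N]

instance : mvLang.IsAlgebraic := fun _ => inferInstanceAs (IsEmpty Empty)

theorem funMap_zero (x : Fin 0 → M) :
    Structure.funMap (L := mvLang) MVFunc.zero x = mvZero M :=
  congrArg _ (Subsingleton.elim _ _)

theorem funMap_neg (x : Fin 1 → M) :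
    Structure.funMap (L := mvLang) MVFunc.neg x = mvNeg (x 0) :=
  congrArg _ (by ext i; fin_cases i; rfl)

theorem funMap_oplus (x : Fin 2 → M) :
    Structure.funMap (L := mvLang) MVFunc.oplus x = mvAdd (x 0) (x 1) :=
  congrArg _ (by ext i; fin_cases i <;> rfl)

/-- A map preserving the MV-operations, as a homomorphism of first-order structures. -/
def mvHom (f : M → N) (map_zero : f (mvZero M) = mvZero N)
    (map_neg : ∀ x, f (mvNeg x) = mvNeg (f x))
    (map_add : ∀ x y, f (mvAdd x y) = mvAdd (f x) (f y)) : M →[mvLang] N where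
  toFun := f
  map_fun' {n} g x := by
    change MVFunc n at g
    cases g with
    | zero => exact (congrArg f (funMap_zero x)).trans (map_zero.trans (funMap_zero _).symm)
    | neg => exact (congrArg f (funMap_neg x)).trans ((map_neg _).trans (funMap_neg (f ∘ x)).symm)
    | oplus =>
      exact (congrArg f (funMap_oplus x)).trans ((map_add _ _).trans (funMap_oplus (f ∘ x)).symm)
  map_rel' r := Empty.elim r

/-- A subset closed under the MV-operations, as a first-order substructure. -/
def mvSubstructure (P : Set M) (zero_mem : mvZero M ∈ P) (neg_mem : ∀ x ∈ P, mvNeg x ∈ P)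
    (add_mem : ∀ x ∈ P, ∀ y ∈ P, mvAdd x y ∈ P) : mvLang.Substructure M where
  carrier := P
  fun_mem {n} g x hx := by
    change MVFunc n at g
    cases g with
    | zero => exact (funMap_zero x).symm ▸ zero_mem
    | neg => exact (funMap_neg x).symm ▸ neg_mem _ (hx 0)
    | oplus => exact (funMap_oplus x).symm ▸ add_mem _ (hx 0) _ (hx 1)

variable {F : Type*} [FunLike F M N] [mvLang.HomClass F M N]

theorem map_mvZero (f : F) : f (mvZero M) = mvZero N :=
  (HomClass.map_fun f _ _).trans (funMap_zero _)

theorem map_mvNeg (f : F) (x : M) : f (mvNeg x) = mvNeg (f x) :=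
  (HomClass.map_fun f _ _).trans (funMap_neg _)

theorem map_mvAdd (f : F) (x y : M) : f (mvAdd x y) = mvAdd (f x) (f y) :=
  (HomClass.map_fun f _ _).trans (funMap_oplus _)

/-- The Łukasiewicz product `x ⊙ y = ¬(¬x ⊕ ¬y)`. -/
def mvMul (x y : M) : M := mvNeg (mvAdd (mvNeg x) (mvNeg y))

/-- The meet `x ⊙ (¬x ⊕ y)` of the lattice order of an MV-algebra. -/
def mvInf (x y : M) : M := mvMul x (mvAdd (mvNeg x) y)

theorem map_mvMul (f : F) (x y : M) : f (mvMul x y) = mvMul (f x) (f y) := by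
  simp only [mvMul, map_mvNeg, map_mvAdd]

theorem map_mvInf (f : F) (x y : M) : f (mvInf x y) = mvInf (f x) (f y) := by
  simp only [mvInf, map_mvMul, map_mvNeg, map_mvAdd]

namespace IsMVAlgebra

theorem of_injective (f : F) (hf : Function.Injective f) (hN : IsMVAlgebra N) :
    IsMVAlgebra M where
  add_assoc x y z := hf (by simp only [map_mvAdd, hN.add_assoc])
  add_comm x y := hf (by rw [map_mvAdd, map_mvAdd, hN.add_comm])
  add_zero x := hf (by rw [map_mvAdd, map_mvZero, hN.add_zero])
  neg_neg x := hf (by rw [map_mvNeg, map_mvNeg, hN.neg_neg])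
  add_neg_zero x := hf (by rw [map_mvAdd, map_mvNeg, map_mvZero, hN.add_neg_zero])
  lukasiewicz x y := hf (by simpa only [map_mvAdd, map_mvNeg] using hN.lukasiewicz _ _)

/-- A first-order MV-algebra in additive notation. -/
abbrev toMVAlgebra (hM : IsMVAlgebra M) : MVAlgebra M where
  zero := mvZero M
  add := mvAdd
  compl := mvNeg
  add_assoc x y z := (hM.add_assoc x y z).symm
  zero_add x := (hM.add_comm _ _).trans (hM.add_zero x)
  add_zero := hM.add_zero
  add_comm := hM.add_comm
  nsmul :=
    letI : Zero M := ⟨mvZero M⟩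
    letI : Add M := ⟨mvAdd⟩
    nsmulRec
  compl_compl := hM.neg_neg
  add_compl_zero := hM.add_neg_zero
  lukasiewicz := hM.lukasiewicz

end IsMVAlgebra

end Homomorphisms

section UnitInterval

instance : mvLang.Structure unitInterval :=
  mvStructure 0 unitInterval.symm fun p q =>
    ⟨min ((p : ℝ) + q) 1, le_min (add_nonneg p.2.1 q.2.1) zero_le_one, min_le_right _ _⟩

theorem coe_mvZero : ((mvZero unitInterval : unitInterval) : ℝ) = 0 := rfl

theorem coe_mvNeg (p : unitInterval) : ((mvNeg p : unitInterval) : ℝ) = 1 - p := rfl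

theorem coe_mvAdd (p q : unitInterval) :
    ((mvAdd p q : unitInterval) : ℝ) = min ((p : ℝ) + q) 1 := rfl

theorem coe_mvMul (p q : unitInterval) :
    ((mvMul p q : unitInterval) : ℝ) = max ((p : ℝ) + q - 1) 0 := by
  simp only [mvMul, coe_mvNeg, coe_mvAdd]
  grind

theorem coe_mvInf (p q : unitInterval) : ((mvInf p q : unitInterval) : ℝ) = min (p : ℝ) q := by
  simp only [mvInf, coe_mvMul, coe_mvAdd, coe_mvNeg]
  grind

theorem isMVAlgebra_unitInterval : IsMVAlgebra unitInterval := by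
  constructor <;> intros <;> ext <;> simp only [coe_mvAdd, coe_mvNeg, coe_mvZero] <;> grind

theorem isMVAlgebra_fuzzy (X : Type*) : IsMVAlgebra (X → unitInterval) where
  add_assoc _ _ _ := funext fun _ => isMVAlgebra_unitInterval.add_assoc _ _ _
  add_comm _ _ := funext fun _ => isMVAlgebra_unitInterval.add_comm _ _
  add_zero _ := funext fun _ => isMVAlgebra_unitInterval.add_zero _
  neg_neg _ := funext fun _ => isMVAlgebra_unitInterval.neg_neg _
  add_neg_zero _ := funext fun _ => isMVAlgebra_unitInterval.add_neg_zero _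
  lukasiewicz _ _ := funext fun _ => isMVAlgebra_unitInterval.lukasiewicz _ _

/-- Evaluation of fuzzy sets at a point. -/
def evalHom {X : Type*} (x : X) : (X → unitInterval) →[mvLang] unitInterval :=
  mvHom (fun f => f x) rfl (fun _ => rfl) fun _ _ => rfl

variable {X S : Type*} [mvLang.Structure S]

/-- The homomorphism into a power of `[0,1]` with prescribed coordinates. -/
def piHom (φ : X → S →[mvLang] unitInterval) : S →[mvLang] (X → unitInterval) :=
  mvHom (fun s x => φ x s) (funext fun x => map_mvZero (φ x))
    (fun s => funext fun x => map_mvNeg (φ x) s) fun s t => funext fun x => map_mvAdd (φ x) s t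

end UnitInterval

/-! ### Characters -/

/-- Homomorphisms to the standard MV-algebra `[0,1]`. -/
abbrev MVCharacter (S : Type*) [mvLang.Structure S] := S →[mvLang] unitInterval

section Characters

variable {S T X Y : Type*} [mvLang.Structure S] [mvLang.Structure T]

/-- The character of an algebra of fuzzy subsets of `X` given by evaluation at a point. -/
def charAt (ι : S ↪[mvLang] (X → unitInterval)) (x : X) : MVCharacter S :=
  (evalHom x).comp ι.toHom

-- A gap `φ s < ψ s` on one side of `1/2` is doubled by `s ⊕ s` or `s ⊙ s`, and a gap containing
-- `1/2` is opened down to `0` by `s ⊙ s`.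
theorem exists_eq_zero_and_pos_of_lt {φ ψ : MVCharacter S} {s : S} (h : φ s < ψ s) :
    ∃ t, (φ t : ℝ) = 0 ∧ (0 : ℝ) < ψ t := by
  have doubling (n : ℕ) : ∀ s : S, 1 < 2 ^ n * ((ψ s : ℝ) - φ s) →
      ∃ t, (φ t : ℝ) = 0 ∧ (0 : ℝ) < ψ t := by
    induction n with
    | zero =>
      intro s hs
      linarith [(ψ s).2.2, (φ s).2.1]
    | succ n ih =>
      intro s hs
      have hlt : (φ s : ℝ) < ψ s := by
        rw [← sub_pos]
        exact pos_of_mul_pos_right (one_pos.trans hs) (by positivity)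
      rw [pow_succ, mul_assoc] at hs
      rcases le_or_gt (ψ s : ℝ) (1 / 2) with hψ | hψ
      · refine ih (mvAdd s s) (hs.trans_eq ?_)
        rw [map_mvAdd, map_mvAdd, coe_mvAdd, coe_mvAdd, min_eq_left (by linarith),
          min_eq_left (by linarith)]
        ring
      rcases le_or_gt (1 / 2) (φ s : ℝ) with hφ | hφ
      · refine ih (mvMul s s) (hs.trans_eq ?_)
        rw [map_mvMul, map_mvMul, coe_mvMul, coe_mvMul, max_eq_left (by linarith),
          max_eq_left (by linarith)]
        ring
      · refine ⟨mvMul s s, ?_, ?_⟩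
        · rw [map_mvMul, coe_mvMul, max_eq_right (by linarith)]
        · rw [map_mvMul, coe_mvMul]
          exact lt_max_of_lt_left (by linarith)
  have hgap : 0 < (ψ s : ℝ) - φ s := sub_pos.2 (Subtype.coe_lt_coe.2 h)
  obtain ⟨n, hn⟩ := pow_unbounded_of_one_lt ((ψ s : ℝ) - φ s)⁻¹ one_lt_two
  exact doubling n s (by rwa [inv_lt_iff_one_lt_mul₀ hgap] at hn)

theorem exists_eq_zero_and_pos_of_ne {φ ψ : MVCharacter S} (h : φ ≠ ψ) :
    ∃ t, (φ t : ℝ) = 0 ∧ (0 : ℝ) < ψ t := by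
  obtain ⟨s, hs⟩ : ∃ s, φ s ≠ ψ s := by
    by_contra! heq
    exact h (Hom.ext heq)
  rcases hs.lt_or_gt with hlt | hgt
  · exact exists_eq_zero_and_pos_of_lt hlt
  · refine exists_eq_zero_and_pos_of_lt (s := mvNeg s) ?_
    rw [← Subtype.coe_lt_coe, map_mvNeg, map_mvNeg, coe_mvNeg, coe_mvNeg]
    exact sub_lt_sub_left (Subtype.coe_lt_coe.2 hgt) 1

section Compact

variable [TopologicalSpace X] [CompactSpace X] {ι : S ↪[mvLang] (X → unitInterval)}

theorem exists_forall_apply_eq_zero (hι : ∀ s, IsLocallyConstant (ι s)) (φ : MVCharacter S) :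
    ∃ x, ∀ s, (ι s x : ℝ) = 0 → (φ s : ℝ) = 0 := by
  by_contra! hcover
  have hpos {s : S} (hs : (φ s : ℝ) ≠ 0) : (0 : ℝ) < φ s := lt_of_le_of_ne (φ s).2.1 hs.symm
  let Z (s : {s : S // (φ s : ℝ) ≠ 0}) : Set X := {x | (ι s x : ℝ) = 0}
  have hφ_one : (φ (mvNeg (mvZero S)) : ℝ) = 1 := by
    rw [map_mvNeg, map_mvZero, coe_mvNeg, coe_mvZero, sub_zero]
  have : Nonempty {s : S // (φ s : ℝ) ≠ 0} := ⟨_, hφ_one.trans_ne one_ne_zero⟩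
  have hdir : Directed (· ⊆ ·) Z := by
    rintro ⟨s, hs⟩ ⟨t, ht⟩
    have hst (x : X) : (ι (mvInf s t) x : ℝ) = min (ι s x : ℝ) (ι t x) := by
      rw [map_mvInf]
      exact coe_mvInf _ _
    refine ⟨⟨mvInf s t, ?_⟩, fun x hx => ?_, fun x hx => ?_⟩
    · rw [map_mvInf, coe_mvInf]
      exact (lt_min (hpos hs) (hpos ht)).ne'
    · exact (hst x).trans ((congrArg (min · _) hx).trans (min_eq_left (ι t x).2.1))
    · exact (hst x).trans ((congrArg (min _ ·) hx).trans (min_eq_right (ι s x).2.1))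
  obtain ⟨⟨s, hs⟩, hZ⟩ := isCompact_univ.elim_directed_cover Z
    (fun s => ((hι s).comp ((↑) : unitInterval → ℝ)).isOpen_fiber 0)
    (fun x _ => Set.mem_iUnion.2 ((hcover x).elim fun s hs => ⟨⟨s, hs.2⟩, hs.1⟩)) hdir
  have hzero : s = mvZero S := ι.injective <| by
    rw [map_mvZero]
    exact funext fun x => Subtype.ext (hZ (Set.mem_univ x))
  exact hs (by rw [hzero, map_mvZero, coe_mvZero])

theorem charAt_surjective (hι : ∀ s, IsLocallyConstant (ι s)) :
    Function.Surjective (charAt ι) := by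
  intro φ
  obtain ⟨x, hx⟩ := exists_forall_apply_eq_zero hι φ
  refine ⟨x, by_contra fun hne => ?_⟩
  obtain ⟨t, hzero, hpos⟩ := exists_eq_zero_and_pos_of_ne hne
  exact hpos.ne' (hx t hzero)

end Compact

end Characters

/-- The rational points of `[0,1]`. -/
def rationalUnit : Set unitInterval := {q | ∃ r : ℚ, (q : ℝ) = r}

section FiniteCharacters

variable {S : Type*} [mvLang.Structure S] [Finite S]

open MVAlgebra in
/-- The character `s ↦ coeff a s / order a` attached to an atom `a` of a finite MV-algebra. -/
noncomputable def atomCharacter (hS : IsMVAlgebra S) {a : S}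
    (ha : letI := hS.toMVAlgebra; IsAtom a) : MVCharacter S :=
  letI := hS.toMVAlgebra
  have hpos : (0 : ℝ) < order a := Nat.cast_pos.2 (order_pos ha)
  mvHom (fun s => ⟨coeff a s / order a, by positivity,
      div_le_one_of_le₀ (Nat.cast_le.2 (coeff_le_order a s)) (Nat.cast_nonneg _)⟩)
    (Subtype.ext <| by
      change ((coeff a (0 : S) : ℕ) : ℝ) / order a = 0
      rw [coeff_zero ha, Nat.cast_zero, zero_div])
    (fun s => Subtype.ext <| by
      change ((coeff a sᶜ : ℕ) : ℝ) / order a = 1 - coeff a s / order a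
      rw [one_sub_div hpos.ne', ← coeff_compl ha s, Nat.cast_add, add_sub_cancel_right])
    (fun s t => Subtype.ext <| by
      change ((coeff a (s + t) : ℕ) : ℝ) / order a =
        min ((coeff a s : ℝ) / order a + coeff a t / order a) 1
      rw [coeff_add ha, Nat.cast_min, Nat.cast_add, ← add_div,
        ← min_div_div_right hpos.le, div_self hpos.ne'])

theorem exists_rational_character_pos (hS : IsMVAlgebra S) {s : S} (hs : s ≠ mvZero S) :
    ∃ φ : MVCharacter S, (∀ t, φ t ∈ rationalUnit) ∧ (0 : ℝ) < φ s := by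
  let := hS.toMVAlgebra
  obtain ⟨a, ha, hle⟩ := (eq_bot_or_exists_atom_le s).resolve_left fun hbot =>
    hs (hbot.trans bot_eq_zero)
  refine ⟨atomCharacter hS ha, fun t => ⟨(MVAlgebra.coeff a t : ℚ) / MVAlgebra.order a, ?_⟩,
    div_pos (Nat.cast_pos.2 (MVAlgebra.coeff_pos ha hle))
      (Nat.cast_pos.2 (MVAlgebra.order_pos ha))⟩
  push_cast
  rfl

theorem exists_rational_character_ne (hS : IsMVAlgebra S) {s t : S} (hst : s ≠ t) :
    ∃ φ : MVCharacter S, (∀ r, φ r ∈ rationalUnit) ∧ φ s ≠ φ t := by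
  let := hS.toMVAlgebra
  wlog hle : ¬ s ≤ t generalizing s t
  · obtain ⟨φ, hφ, hne⟩ := this hst.symm fun hge => hst (le_antisymm (not_not.1 hle) hge)
    exact ⟨φ, hφ, hne.symm⟩
  obtain ⟨φ, hφ, hpos⟩ := exists_rational_character_pos hS (s := s - t) fun hzero =>
    hle (tsub_eq_zero_iff_le.1 hzero)
  refine ⟨φ, hφ, fun heq => hpos.ne' ?_⟩
  change (φ (mvNeg (mvAdd (mvNeg s) t)) : ℝ) = 0
  rw [map_mvNeg, map_mvAdd, map_mvNeg, heq, coe_mvNeg, coe_mvAdd, coe_mvNeg, sub_add_cancel,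
    min_self, sub_self]

end FiniteCharacters

/-! ### Lifting surjections onto finite sets -/

section FiniteSurjections

variable {A B Y : Type*}

theorem exists_injective_lift [Countable B] {q : Y → A} {r : B → A}
    (hq : ∀ b, (q ⁻¹' {r b}).Infinite) :
    ∃ p : B → Y, Function.Injective p ∧ ∀ b, q (p b) = r b := by
  obtain ⟨e, he⟩ := exists_injective_nat B
  have hfibre (a : Set.range r) : ∃ j : ℕ → Y, Function.Injective j ∧ ∀ n, q (j n) = a := by
    obtain ⟨_, b, rfl⟩ := a
    exact ⟨_, Subtype.val_injective.comp ((hq b).natEmbedding _).injective,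
      fun n => ((hq b).natEmbedding _ n).2⟩
  choose j hj hqj using hfibre
  refine ⟨fun b => j (Set.rangeFactorization r b) (e b), fun b c hbc => he ?_,
    fun b => hqj _ _⟩
  have hr : Set.rangeFactorization r b = Set.rangeFactorization r c := by
    apply Subtype.ext
    rw [← hqj _ (e b), ← hqj _ (e c)]
    exact congrArg q hbc
  simp only [hr] at hbc
  exact hj _ hbc

variable [TopologicalSpace Y] [TotallySeparatedSpace Y]

theorem exists_isLocallyConstant_leftInverse [Finite B] [Nonempty B] {p : B → Y}
    (hp : Function.Injective p) :
    ∃ g : Y → B, IsLocallyConstant g ∧ Function.LeftInverse g p := by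
  have hsep (i : {i : B × B // i.1 ≠ i.2}) :
      ∃ U : Set Y, IsClopen U ∧ p i.1.1 ∈ U ∧ p i.1.2 ∈ Uᶜ :=
    exists_isClopen_of_totally_separated (hp.ne i.2)
  choose U hU hmem hnotMem using hsep
  let G := LocallyConstant.unflip fun i => LocallyConstant.charFn ℕ (hU i)
  have hGp : Function.Injective (G ∘ p) := by
    intro b c hbc
    by_contra hne
    have hchar := congrFun hbc ⟨(b, c), hne⟩
    exact hnotMem ⟨(b, c), hne⟩ ((LocallyConstant.charFn_eq_one ℕ _ (hU _)).1
      (hchar.symm.trans ((LocallyConstant.charFn_eq_one ℕ _ (hU _)).2 (hmem ⟨(b, c), hne⟩))))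
  exact ⟨Function.invFun (G ∘ p) ∘ G, G.isLocallyConstant.comp _,
    Function.leftInverse_invFun hGp⟩

theorem infinite_fibre_of_perfectSpace [PerfectSpace Y] {q : Y → A} (hq : IsLocallyConstant q)
    (y : Y) : (q ⁻¹' {q y}).Infinite :=
  infinite_of_mem_nhds y ((hq.isOpen_fiber (q y)).mem_nhds rfl)

-- Perfectness makes the fibres of `q` infinite, so every point of `B` can be given its own point
-- of `Y`; near these points `k` is prescribed, elsewhere it only has to lie over `q`.
theorem exists_isLocallyConstant_surjective_lift [PerfectSpace Y] [Finite B] {q : Y → A}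
    {r : B → A} (hq : IsLocallyConstant q) (hq_surj : Function.Surjective q)
    (hr : Function.Surjective r) :
    ∃ k : Y → B, IsLocallyConstant k ∧ Function.Surjective k ∧ ∀ y, r (k y) = q y := by
  classical
  obtain ⟨c, hc⟩ := hr.hasRightInverse
  rcases isEmpty_or_nonempty B with _ | _
  · exact ⟨c ∘ q, hq.comp c, isEmptyElim, fun y => hc (q y)⟩
  obtain ⟨p, hp, hqp⟩ := exists_injective_lift (q := q) (r := r) fun b => by
    obtain ⟨y, hy⟩ := hq_surj (r b)
    exact hy ▸ infinite_fibre_of_perfectSpace hq y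
  obtain ⟨g, hg, hgp⟩ := exists_isLocallyConstant_leftInverse hp
  let choice (b : B) (a : A) : B := if r b = a then b else c a
  refine ⟨fun y => choice (g y) (q y), hg.comp₂ hq choice, fun b => ⟨p b, ?_⟩, fun y => ?_⟩
  · simp only [choice, hgp b, hqp b, if_true]
  · by_cases h : r (g y) = q y
    · simp only [choice, if_pos h, h]
    · simp only [choice, if_neg h, hc (q y)]

end FiniteSurjections

section UnitFractions

/-- The subalgebra `{0, 1/N, …, (N-1)/N, 1}` of `[0,1]`. Its elements are described without
division, so that it is all of `[0,1]` for `N = 0`. -/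
def unitFractions (N : ℕ) : mvLang.Substructure unitInterval :=
  mvSubstructure {q | ∃ k : ℕ, (q : ℝ) * N = k}
    ⟨0, by rw [coe_mvZero, zero_mul, Nat.cast_zero]⟩
    (by
      rintro q ⟨k, hk⟩
      have hle : (k : ℝ) ≤ N := hk ▸ mul_le_of_le_one_left N.cast_nonneg q.2.2
      refine ⟨N - k, ?_⟩
      rw [coe_mvNeg, sub_mul, hk, one_mul, Nat.cast_sub (Nat.cast_le.1 hle)])
    (by
      rintro p ⟨k, hk⟩ q ⟨l, hl⟩
      refine ⟨min (k + l) N, ?_⟩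
      rw [coe_mvAdd, min_mul_of_nonneg _ _ N.cast_nonneg, add_mul, hk, hl, one_mul,
        Nat.cast_min, Nat.cast_add])

theorem mem_unitFractions_of_den_dvd {N : ℕ} {q : unitInterval} {r : ℚ} (hq : (q : ℝ) = r)
    (hN : r.den ∣ N) : q ∈ unitFractions N := by
  obtain ⟨m, rfl⟩ := hN
  have hr : 0 ≤ r := by exact_mod_cast hq ▸ q.2.1
  lift r to ℚ≥0 using hr
  refine ⟨r.num * m, ?_⟩
  have hden : (r : ℝ) * r.den = r.num := by exact_mod_cast r.mul_den_eq_num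
  rw [hq, Nat.cast_mul, Nat.cast_mul, ← mul_assoc]
  exact congrArg (· * (m : ℝ)) hden

theorem finite_unitFractions {N : ℕ} (hN : N ≠ 0) :
    (unitFractions N : Set unitInterval).Finite := by
  have hN' : (0 : ℝ) < N := Nat.cast_pos.2 (Nat.pos_of_ne_zero hN)
  refine (((Set.finite_Iic N).image fun k : ℕ => (k : ℝ) / N).preimage
    Subtype.val_injective.injOn).subset ?_
  rintro q ⟨k, hk⟩
  refine ⟨k, Nat.cast_le.1 (hk ▸ mul_le_of_le_one_left hN'.le q.2.2 : (k : ℝ) ≤ N), ?_⟩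
  exact (div_eq_iff hN'.ne').2 hk.symm

theorem exists_subset_unitFractions {W : Set unitInterval} (hW : W.Finite)
    (hrat : W ⊆ rationalUnit) : ∃ N ≠ 0, W ⊆ unitFractions N := by
  choose! r hr using show ∀ q ∈ W, ∃ r : ℚ, (q : ℝ) = r from fun q hq => hrat hq
  refine ⟨∏ q ∈ hW.toFinset, (r q).den, Finset.prod_ne_zero_iff.2 fun q _ => (r q).den_nz,
    fun q hq => mem_unitFractions_of_den_dvd (hr q hq) ?_⟩
  exact Finset.dvd_prod_of_mem (fun q => (r q).den) (hW.mem_toFinset.2 hq)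

end UnitFractions

section LocallyFinite

variable {X S : Type*} [mvLang.Structure S]

-- The generators factor through a finite quotient `C` of `X` with values in some `unitFractions N`,
-- and the functions that do so form a finite algebra.
theorem finite_closure_of_finite_range {G : Set (X → unitInterval)} (hG : G.Finite)
    (hval : (Set.range fun x (g : G) => g.1 x).Finite) (hrat : ∀ g ∈ G, ∀ x, g x ∈ rationalUnit) :
    Finite (Substructure.closure mvLang G) := by
  have := hG.to_subtype
  let C := Set.range fun x (g : G) => g.1 x
  have : Finite C := hval.to_subtype
  let c (x : X) : C := ⟨fun g => g.1 x, x, rfl⟩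
  have hvalues : (Set.range fun i : C × G => i.1.1 i.2).Finite := Set.finite_range _
  obtain ⟨N, hN, hvalues_le⟩ := exists_subset_unitFractions hvalues <| by
    rintro _ ⟨⟨⟨_, x, rfl⟩, g⟩, rfl⟩
    exact hrat g g.2 x
  let U : mvLang.Substructure (C → unitInterval) := ⨅ i, (unitFractions N).comap (evalHom i)
  have hU_mem {f : C → unitInterval} : f ∈ U ↔ ∀ i, f i ∈ unitFractions N := by
    simp only [U, Substructure.mem_iInf, Substructure.mem_comap]
    rfl
  have hU : (U : Set (C → unitInterval)).Finite :=
    (Set.Finite.pi' fun _ => finite_unitFractions hN).subset fun f hf => hU_mem.1 hf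
  let pull : (C → unitInterval) →[mvLang] (X → unitInterval) := piHom fun x => evalHom (c x)
  have hle : Substructure.closure mvLang G ≤ U.map pull := Substructure.closure_le.2 fun g hg =>
    ⟨fun i => i.1 ⟨g, hg⟩, hU_mem.2 fun i => hvalues_le ⟨(i, ⟨g, hg⟩), rfl⟩, rfl⟩
  exact (hU.image pull).subset hle

end LocallyFinite

/-! ### Algebras of locally constant functions -/

/-- `S` is represented by `ι` as the algebra of all locally constant functions on `X` with values
in `V`. -/
def IsLocConstRep {X S : Type*} [TopologicalSpace X] [mvLang.Structure S] (V : Set unitInterval)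
    (ι : S ↪[mvLang] (X → unitInterval)) : Prop :=
  ∀ f, f ∈ Set.range ι ↔ IsLocallyConstant f ∧ ∀ x, f x ∈ V

theorem isLocallyConstant_charAt {X S : Type*} [TopologicalSpace X] [mvLang.Structure S]
    [Finite S] {ι : S ↪[mvLang] (X → unitInterval)} (hι : ∀ s, IsLocallyConstant (ι s)) :
    IsLocallyConstant (charAt ι) :=
  .desc _ (fun φ : MVCharacter S => (φ : S → unitInterval))
    (LocallyConstant.unflip fun s => ⟨ι s, hι s⟩).isLocallyConstant DFunLike.coe_injective

namespace IsLocConstRep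

variable {X S T : Type*} [TopologicalSpace X] [mvLang.Structure S] [mvLang.Structure T]
variable {V : Set unitInterval} {ι : S ↪[mvLang] (X → unitInterval)}

theorem isLocallyConstant (h : IsLocConstRep V ι) (s : S) : IsLocallyConstant (ι s) :=
  ((h _).1 ⟨s, rfl⟩).1

theorem apply_mem (h : IsLocConstRep V ι) (s : S) (x : X) : ι s x ∈ V :=
  ((h _).1 ⟨s, rfl⟩).2 x

theorem comp_equiv (h : IsLocConstRep V ι) (e : T ≃[mvLang] S) :
    IsLocConstRep V (ι.comp e.toEmbedding) := fun f => by
  rw [← h f, ← e.surjective.range_comp ι]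
  rfl

theorem exists_hom_lift (h : IsLocConstRep V ι) {φ : X → MVCharacter T}
    (hφ : ∀ t, IsLocallyConstant fun x => φ x t) (hV : ∀ x t, φ x t ∈ V) :
    ∃ g : T →[mvLang] S, ∀ t x, ι (g t) x = φ x t := by
  choose g hg using fun t => (h (piHom φ t)).2 ⟨hφ t, fun x => hV x t⟩
  refine ⟨mvHom g (ι.injective ?_) (fun t => ι.injective ?_) fun s t => ι.injective ?_,
    fun t => congrFun (hg t)⟩
  · rw [hg, map_mvZero, map_mvZero]
  · rw [map_mvNeg, hg, hg, map_mvNeg]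
  · rw [map_mvAdd, hg, hg, hg, map_mvAdd]

theorem exists_embedding_lift (h : IsLocConstRep V ι) {F : Type*} {ψ : F → MVCharacter T}
    (hV : ∀ i t, ψ i t ∈ V) (hψ : ∀ s t, (∀ i, ψ i s = ψ i t) → s = t) {k : X → F}
    (hk : IsLocallyConstant k) (hk_surj : Function.Surjective k) :
    ∃ g : T ↪[mvLang] S, ∀ t x, ι (g t) x = ψ (k x) t := by
  obtain ⟨g, hg⟩ := h.exists_hom_lift (φ := fun x => ψ (k x)) (fun t => hk.comp (ψ · t))
    fun x => hV (k x)
  have hg_inj : Function.Injective g := fun s t hst => hψ s t <| hk_surj.forall.2 fun x => by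
    rw [← hg, ← hg, hst]
  exact ⟨.ofInjective hg_inj, hg⟩

theorem exists_embedding_of_finite [TotallySeparatedSpace X] [PerfectSpace X] [Nonempty X]
    (h : IsLocConstRep rationalUnit ι) [Finite T] [Nontrivial T] (hT : IsMVAlgebra T) :
    Nonempty (T ↪[mvLang] S) := by
  let F := {p : T × T // p.1 ≠ p.2}
  choose ψ hψ_rat hψ_ne using fun p : F => exists_rational_character_ne hT p.2
  obtain ⟨a, b, hab⟩ := exists_pair_ne T
  obtain ⟨k, hk, hk_surj, -⟩ := exists_isLocallyConstant_surjective_lift (B := F)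
    (IsLocallyConstant.const () : IsLocallyConstant fun _ : X => ())
    (fun _ => ⟨Classical.arbitrary X, rfl⟩) (r := fun _ => ()) fun _ => ⟨⟨(a, b), hab⟩, rfl⟩
  obtain ⟨g, -⟩ := h.exists_embedding_lift hψ_rat
    (fun s t hst => by_contra fun hne => hψ_ne ⟨(s, t), hne⟩ (hst _)) hk hk_surj
  exact ⟨g⟩

variable [CompactSpace X]

theorem finite_of_fg (h : IsLocConstRep V ι) (hV : V ⊆ rationalUnit) {K : mvLang.Substructure S}
    (hK : K.FG) : Finite K := by
  obtain ⟨G, hG, rfl⟩ := Substructure.fg_def.1 hK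
  have := (hG.image ι).to_subtype
  have hval : IsLocallyConstant fun x (g : ι '' G) => g.1 x := by
    refine (LocallyConstant.unflip fun g : ι '' G => ⟨g.1, ?_⟩).isLocallyConstant
    obtain ⟨_, s, -, rfl⟩ := g
    exact h.isLocallyConstant s
  have hfin : Finite (Substructure.closure mvLang (ι.toHom '' G)) :=
    finite_closure_of_finite_range (hG.image ι) hval.range_finite <| by
      rintro _ ⟨s, -, rfl⟩ x
      exact hV (h.apply_mem s x)
  rw [Substructure.closure_image] at hfin
  exact (Set.Finite.of_finite_image hfin ι.injective.injOn).to_subtype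

-- Characters of the finite algebras `S₀ ≤ S₁` are points of `X` and, via `f`, of `Y`; extending `f`
-- to `S₁` amounts to lifting the map `Y → MVCharacter S₀` through the restriction map.
theorem isExtensionPair (h : IsLocConstRep V ι) (hV : V ⊆ rationalUnit) {Y : Type*}
    [TopologicalSpace Y] [CompactSpace Y] [TotallySeparatedSpace Y] [PerfectSpace Y]
    {ι' : T ↪[mvLang] (Y → unitInterval)} (h' : IsLocConstRep V ι') :
    mvLang.IsExtensionPair S T := by
  rw [isExtensionPair_iff_exists_embedding_closure_singleton_sup]
  intro S₀ hS₀ f m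
  set S₁ := Substructure.closure mvLang {m} ⊔ S₀
  have : Finite S₀ := h.finite_of_fg hV hS₀
  have : Finite S₁ := h.finite_of_fg hV ((Substructure.fg_closure_singleton m).sup hS₀)
  have hpoint (K : mvLang.Substructure S) : Function.Surjective (charAt (ι.comp K.subtype)) :=
    charAt_surjective fun s => h.isLocallyConstant s
  have : Finite (MVCharacter S₁) :=
    Set.finite_univ_iff.1 <| (hpoint S₁).range_eq ▸
      (isLocallyConstant_charAt fun s : S₁ => h.isLocallyConstant s).range_finite
  let restrict (φ : MVCharacter S₁) : MVCharacter S₀ :=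
    φ.comp (Substructure.inclusion (le_sup_right : S₀ ≤ S₁)).toHom
  have hrestrict : Function.Surjective restrict := fun φ => by
    obtain ⟨x, rfl⟩ := hpoint S₀ φ
    exact ⟨charAt (ι.comp S₁.subtype) x, rfl⟩
  have hloc (s : S₀) : IsLocallyConstant (ι'.comp f s) := h'.isLocallyConstant (f s)
  obtain ⟨k, hk, hk_surj, hk_restrict⟩ := exists_isLocallyConstant_surjective_lift
    (isLocallyConstant_charAt hloc) (charAt_surjective hloc) hrestrict
  obtain ⟨g, hg⟩ := h'.exists_embedding_lift (ψ := id)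
    (fun φ s => by
      obtain ⟨x, rfl⟩ := hpoint S₁ φ
      exact h.apply_mem s x)
    (fun s t hst => Subtype.ext <| ι.injective <| funext fun x =>
      hst (charAt (ι.comp S₁.subtype) x))
    hk hk_surj
  refine ⟨g, Embedding.ext fun s => ι'.injective (funext fun y => ?_)⟩
  exact (DFunLike.congr_fun (hk_restrict y) s).symm.trans (hg _ y).symm

theorem isFraisseLimit {S : Type u} [mvLang.Structure S] [Countable S]
    {ι : S ↪[mvLang] (X → unitInterval)} [TotallySeparatedSpace X] [PerfectSpace X] [Nonempty X]
    (h : IsLocConstRep rationalUnit ι) : IsFraisseLimit finiteMV.{u} S where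
  ultrahomogeneous := (isUltrahomogeneous_iff_IsExtensionPair Structure.cg_of_countable).2
    (h.isExtensionPair subset_rfl h)
  age := by
    ext N
    constructor
    · rintro ⟨hfg, ⟨f⟩⟩
      have : Finite f.toHom.range := h.finite_of_fg subset_rfl (hfg.range f.toHom)
      refine ⟨(isMVAlgebra_fuzzy X).of_injective (ι.comp f) (ι.comp f).injective,
        .of_injective f.equivRange f.equivRange.injective,
        ⟨mvZero N, mvNeg (mvZero N), fun hzero => ?_⟩⟩
      have hval := congrArg (fun n => (charAt (ι.comp f) (Classical.arbitrary X) n : ℝ)) hzero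
      simp only [map_mvNeg, map_mvZero, coe_mvNeg, coe_mvZero, sub_zero, zero_ne_one] at hval
    · rintro ⟨hN, hfin, hnt⟩
      exact ⟨Structure.FG.of_finite, h.exists_embedding_of_finite hN⟩

theorem nonempty_equiv [TotallySeparatedSpace X] [PerfectSpace X] [Nonempty X] {Y : Type*}
    [TopologicalSpace Y] [CompactSpace Y] [TotallySeparatedSpace Y] [PerfectSpace Y] [Nonempty Y]
    [Countable S] [Countable T] {ι' : T ↪[mvLang] (Y → unitInterval)} (h : IsLocConstRep V ι)
    (hV : V ⊆ rationalUnit) (h' : IsLocConstRep V ι') : Nonempty (S ≃[mvLang] T) := by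
  have x₀ := Classical.arbitrary X
  have hconst (s : (⊥ : mvLang.Substructure S)) (x : X) : ι s x = ι s x₀ :=
    (bot_le : ⊥ ≤ (charAt ι x).eqLocus (charAt ι x₀)) s.2
  obtain ⟨g, -⟩ := h'.exists_embedding_lift
    (ψ := fun _ : Unit => charAt (ι.comp (⊥ : mvLang.Substructure S).subtype) x₀)
    (fun _ s => h.apply_mem s x₀)
    (fun s t hst => Subtype.ext <| ι.injective <| funext fun x =>
      (hconst s x).trans ((hst ()).trans (hconst t x).symm))
    (.const ()) fun _ => ⟨Classical.arbitrary Y, rfl⟩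
  obtain ⟨f, -⟩ := equiv_between_cg Structure.cg_of_countable Structure.cg_of_countable
    ⟨⟨⊥, g.toHom.range, g.equivRange⟩, Substructure.fg_bot⟩ (h.isExtensionPair hV h')
    (h'.isExtensionPair hV h)
  exact ⟨f⟩

end IsLocConstRep

/-! ### Automorphisms and the Boolean center -/

/-- The two-element subalgebra `{0, 1}` of `[0,1]`. -/
def booleanUnit : Set unitInterval := {0, 1}

theorem booleanUnit_subset_rationalUnit : booleanUnit ⊆ rationalUnit := by
  rintro _ (rfl | rfl)
  · exact ⟨0, Rat.cast_zero.symm⟩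
  · exact ⟨1, Rat.cast_one.symm⟩

theorem charFn_mem_booleanUnit {X : Type*} [TopologicalSpace X] {U : Set X} (hU : IsClopen U)
    (x : X) : LocallyConstant.charFn unitInterval hU x ∈ booleanUnit := by
  by_cases hx : x ∈ U
  · exact Or.inr ((LocallyConstant.charFn_eq_one _ x hU).2 hx)
  · exact Or.inl ((LocallyConstant.charFn_eq_zero _ x hU).2 hx)

namespace IsLocConstRep

section Duality

variable {X Y S T : Type*} [TopologicalSpace X] [TopologicalSpace Y] [mvLang.Structure S]
  [mvLang.Structure T] {V : Set unitInterval} {ι : S ↪[mvLang] (X → unitInterval)}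
  {ι' : T ↪[mvLang] (Y → unitInterval)}

theorem exists_apply_eq_one_iff (h : IsLocConstRep V ι) (hV : booleanUnit ⊆ V) {U : Set X}
    (hU : IsClopen U) : ∃ s, ∀ x, ι s x = 1 ↔ x ∈ U := by
  obtain ⟨s, hs⟩ := (h (LocallyConstant.charFn unitInterval hU)).2
    ⟨LocallyConstant.isLocallyConstant _, fun x => hV (charFn_mem_booleanUnit hU x)⟩
  exact ⟨s, fun x => hs ▸ LocallyConstant.charFn_eq_one _ x hU⟩

theorem exists_equiv_of_homeomorph (h : IsLocConstRep V ι) (h' : IsLocConstRep V ι')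
    (k : X ≃ₜ Y) : ∃ e : S ≃[mvLang] T, ∀ s y, ι' (e s) y = ι s (k.symm y) := by
  obtain ⟨g, hg⟩ := h'.exists_hom_lift (φ := fun y => charAt ι (k.symm y))
    (fun s => (h.isLocallyConstant s).comp_continuous k.symm.continuous)
    fun y s => h.apply_mem s (k.symm y)
  obtain ⟨g', hg'⟩ := h.exists_hom_lift (φ := fun x => charAt ι' (k x))
    (fun t => (h'.isLocallyConstant t).comp_continuous k.continuous)
    fun x t => h'.apply_mem t (k x)
  refine ⟨{ g with
    invFun := g'
    left_inv := fun s => ι.injective (funext fun x => ?_)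
    right_inv := fun t => ι'.injective (funext fun y => ?_)
    map_rel' := fun r => isEmptyElim r }, hg⟩
  · exact (hg' _ x).trans ((hg s (k x)).trans (by rw [k.symm_apply_apply]; rfl))
  · exact (hg _ y).trans ((hg' t (k.symm y)).trans (by rw [k.apply_symm_apply]; rfl))

variable [TotallySeparatedSpace X]

theorem eq_of_forall_apply_eq (h : IsLocConstRep V ι) (hV : booleanUnit ⊆ V) {x y : X}
    (hxy : ∀ s, ι s x = ι s y) : x = y := by
  by_contra hne
  obtain ⟨U, hU, hx, hy⟩ := exists_isClopen_of_totally_separated hne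
  obtain ⟨s, hs⟩ := h.exists_apply_eq_one_iff hV hU
  exact hy ((hs y).1 ((hxy s).symm.trans ((hs x).2 hx)))

variable [CompactSpace X]

theorem exists_continuous_of_hom (h : IsLocConstRep V ι) (hV : booleanUnit ⊆ V)
    (h' : IsLocConstRep V ι') (σ : S →[mvLang] T) :
    ∃ k : Y → X, Continuous k ∧ ∀ s y, ι' (σ s) y = ι s (k y) := by
  choose k hk using fun y => charAt_surjective h.isLocallyConstant ((charAt ι' y).comp σ)
  have hk_apply (s : S) (y : Y) : ι' (σ s) y = ι s (k y) := (DFunLike.congr_fun (hk y) s).symm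
  refine ⟨k, isTopologicalBasis_isClopen.continuous_iff.2 fun U hU => ?_, hk_apply⟩
  obtain ⟨s, hs⟩ := h.exists_apply_eq_one_iff hV hU
  have hpreimage : k ⁻¹' U = {y | ι' (σ s) y = 1} := Set.ext fun y => by
    rw [Set.mem_preimage, ← hs, ← hk_apply, Set.mem_ofPred_eq]
  exact hpreimage ▸ (h'.isLocallyConstant (σ s)).isOpen_fiber 1

theorem exists_homeomorph_of_equiv [TotallySeparatedSpace Y] [CompactSpace Y]
    (h : IsLocConstRep V ι) (hV : booleanUnit ⊆ V) (h' : IsLocConstRep V ι')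
    (e : S ≃[mvLang] T) : ∃ k : X ≃ₜ Y, ∀ s y, ι' (e s) y = ι s (k.symm y) := by
  obtain ⟨k, hk, hk_apply⟩ := h.exists_continuous_of_hom hV h' e.toHom
  obtain ⟨l, hl, hl_apply⟩ := h'.exists_continuous_of_hom hV h e.symm.toHom
  refine ⟨⟨⟨l, k, fun x => h.eq_of_forall_apply_eq hV fun s => ?_,
    fun y => h'.eq_of_forall_apply_eq hV fun t => ?_⟩, hl, hk⟩, hk_apply⟩
  · exact (hk_apply s (l x)).symm.trans ((hl_apply _ x).symm.trans
      (congrArg (ι · x) (e.symm_apply_apply s)))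
  · exact (hl_apply t (k y)).symm.trans ((hk_apply _ y).symm.trans
      (congrArg (ι' · y) (e.apply_symm_apply t)))

end Duality

section Automorphisms

variable {X S : Type*} [TopologicalSpace X] [TotallySeparatedSpace X] [CompactSpace X]
  [mvLang.Structure S] {V : Set unitInterval} {ι : S ↪[mvLang] (X → unitInterval)}

theorem exists_homeomorph_mulEquiv (h : IsLocConstRep V ι) (hV : booleanUnit ⊆ V) :
    ∃ Φ : (X ≃ₜ X) ≃* (S ≃[mvLang] S), ∀ k s x, ι (Φ k s) x = ι s (k.symm x) := by
  choose Φ hΦ using h.exists_equiv_of_homeomorph h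
  have hΦ_inj : Function.Injective Φ := fun k l hkl => by
    refine Homeomorph.symm_bijective.injective (Homeomorph.ext fun x => ?_)
    refine h.eq_of_forall_apply_eq hV fun s => ?_
    rw [← hΦ, ← hΦ, hkl]
  have hΦ_surj : Function.Surjective Φ := fun σ => by
    obtain ⟨k, hk⟩ := h.exists_homeomorph_of_equiv hV h σ
    exact ⟨k, DFunLike.ext _ _ fun s => ι.injective <| funext fun x =>
      (hΦ k s x).trans (hk s x).symm⟩
  have hΦ_mul (k l : X ≃ₜ X) : Φ (k * l) = Φ k * Φ l :=
    DFunLike.ext _ _ fun s => ι.injective <| funext fun x => by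
      change _ = ι (Φ k (Φ l s)) x
      rw [hΦ, hΦ, hΦ]
      rfl
  exact ⟨.mk' (.ofBijective Φ ⟨hΦ_inj, hΦ_surj⟩) hΦ_mul, hΦ⟩

end Automorphisms

end IsLocConstRep

section BooleanCenter

variable {X M : Type*} [mvLang.Structure M]

theorem mvAdd_self_eq_iff {p : unitInterval} : mvAdd p p = p ↔ p ∈ booleanUnit := by
  simp only [booleanUnit, Set.mem_insert_iff, Set.mem_singleton_iff, Subtype.ext_iff, coe_mvAdd,
    Set.Icc.coe_zero, Set.Icc.coe_one]
  grind

theorem mem_booleanCenter_iff (ι : M ↪[mvLang] (X → unitInterval)) (hM : IsMVAlgebra M) (b : M) :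
    b ∈ booleanCenter hM ↔ ∀ x, ι b x ∈ booleanUnit := by
  change mvAdd b b = b ↔ _
  rw [← ι.injective.eq_iff, map_mvAdd, funext_iff]
  exact forall_congr' fun x => mvAdd_self_eq_iff

namespace IsLocConstRep

variable [TopologicalSpace X] {V : Set unitInterval} {ι : M ↪[mvLang] (X → unitInterval)}

theorem comp_booleanCenter_subtype (h : IsLocConstRep V ι) (hV : booleanUnit ⊆ V)
    (hM : IsMVAlgebra M) : IsLocConstRep booleanUnit (ι.comp (booleanCenter hM).subtype) := by
  refine fun f => ⟨?_, fun ⟨hf, hf_val⟩ => ?_⟩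
  · rintro ⟨b, rfl⟩
    exact ⟨h.isLocallyConstant b, (mem_booleanCenter_iff ι hM b).1 b.2⟩
  · obtain ⟨b, rfl⟩ := (h f).2 ⟨hf, fun x => hV (hf_val x)⟩
    exact ⟨⟨b, (mem_booleanCenter_iff ι hM b).2 hf_val⟩, rfl⟩

theorem exists_restrict_booleanCenter_mulEquiv [TotallySeparatedSpace X] [CompactSpace X]
    (h : IsLocConstRep V ι) (hV : booleanUnit ⊆ V) (hM : IsMVAlgebra M) :
    ∃ R : (M ≃[mvLang] M) ≃* (booleanCenter hM ≃[mvLang] booleanCenter hM),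
      ∀ σ b, (R σ b : M) = σ b := by
  obtain ⟨Φ, hΦ⟩ := h.exists_homeomorph_mulEquiv hV
  obtain ⟨Ψ, hΨ⟩ := (h.comp_booleanCenter_subtype hV hM).exists_homeomorph_mulEquiv subset_rfl
  refine ⟨Φ.symm.trans Ψ, fun σ b => ?_⟩
  obtain ⟨k, rfl⟩ := Φ.surjective σ
  refine ι.injective <| funext fun x => ?_
  rw [MulEquiv.trans_apply, Φ.symm_apply_apply, hΦ]
  exact hΨ k b x

end IsLocConstRep

end BooleanCenter

/-! ### Boolean algebras -/

section BooleanStructure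

variable {B C : Type*} [BooleanAlgebra B] [BooleanAlgebra C]

/-- A Boolean algebra as an MV-algebra, with join as `⊕` and complement as `¬`. -/
abbrev booleanMVStructure (B : Type*) [BooleanAlgebra B] : mvLang.Structure B :=
  mvStructure ⊥ compl (· ⊔ ·)

attribute [local instance] booleanMVStructure

/-- An isomorphism of Boolean algebras, seen as MV-algebras, from an order isomorphism. -/
def mvEquivOfOrderIso (g : B ≃o C) : B ≃[mvLang] C :=
  { mvHom g (map_bot g) (map_compl g) (map_sup g) with
    invFun := g.symm
    left_inv := g.symm_apply_apply
    right_inv := g.apply_symm_apply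
    map_rel' := fun r => isEmptyElim r }

/-- An isomorphism of Boolean algebras, seen as MV-algebras, is an order isomorphism. -/
def orderIsoOfMVEquiv (e : B ≃[mvLang] C) : B ≃o C where
  toEquiv := e.toEquiv
  map_rel_iff' {a b} := by
    have hsup : e (a ⊔ b) = e a ⊔ e b := map_mvAdd e a b
    change e a ≤ e b ↔ a ≤ b
    rw [← sup_eq_right, ← hsup, e.injective.eq_iff, sup_eq_right]

/-- The automorphisms of a Boolean algebra, seen as an MV-algebra, are its order automorphisms. -/
def autMulEquivOrderIso (B : Type*) [BooleanAlgebra B] : (B ≃[mvLang] B) ≃* (B ≃o B) where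
  toFun := orderIsoOfMVEquiv
  invFun := mvEquivOfOrderIso
  map_mul' _ _ := rfl

end BooleanStructure

/-- Conjugation by an isomorphism. -/
def autCongr {M N : Type*} [mvLang.Structure M] [mvLang.Structure N] (e : M ≃[mvLang] N) :
    (M ≃[mvLang] M) ≃* (N ≃[mvLang] N) where
  toFun σ := e.comp (σ.comp e.symm)
  invFun τ := e.symm.comp (τ.comp e)
  left_inv σ := DFunLike.ext _ _ fun x => by
    change e.symm (e (σ (e.symm (e x)))) = σ x
    rw [e.symm_apply_apply, e.symm_apply_apply]
  right_inv τ := DFunLike.ext _ _ fun x => by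
    change e (e.symm (τ (e (e.symm x)))) = τ x
    rw [e.apply_symm_apply, e.apply_symm_apply]
  map_mul' σ τ := DFunLike.ext _ _ fun x => by
    change e (σ (τ (e.symm x))) = e (σ (e.symm (e (τ (e.symm x)))))
    rw [e.symm_apply_apply]

section StoneDuality

open TopologicalSpace

/-- The elements of a Boolean algebra are the idempotents of its Boolean ring. -/
def idempotentOrderIso (B : Type*) [BooleanAlgebra B] :
    B ≃o {e : AsBoolRing B // IsIdempotentElem e} where
  toFun b := ⟨toBoolRing b, BooleanRing.isIdempotentElem _⟩
  invFun e := ofBoolRing e.1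
  map_rel_iff' {a b} := by
    change toBoolRing a * toBoolRing b = toBoolRing a ↔ _
    rw [← toBoolRing_inf, toBoolRing_inj, inf_eq_left]

/-- Stone representation of a Boolean algebra, with the prime spectrum as Stone space. -/
noncomputable def stoneOrderIso (B : Type*) [BooleanAlgebra B] :
    B ≃o Clopens (PrimeSpectrum (AsBoolRing B)) :=
  (idempotentOrderIso B).trans PrimeSpectrum.isIdempotentElemEquivClopens

instance (R : Type*) [BooleanRing R] : TotallySeparatedSpace (PrimeSpectrum R) := by
  refine totallySeparatedSpace_of_t0_of_basis_clopen <|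
    PrimeSpectrum.isTopologicalBasis_basic_opens.of_isOpen_of_subset (fun U hU => hU.isOpen) ?_
  rintro _ ⟨e, rfl⟩
  exact (PrimeSpectrum.isIdempotentElemEquivClopens
    ⟨e, BooleanRing.isIdempotentElem e⟩).isClopen

variable {X : Type*} [TopologicalSpace X]

theorem perfectSpace_of_forall_not_isAtom [T1Space X] (h : ∀ U : Clopens X, ¬ IsAtom U) :
    PerfectSpace X := by
  rw [perfectSpace_iff_forall_not_isolated]
  refine fun x => ⟨fun hx => h ⟨{x}, isClosed_singleton, ?_⟩ ⟨fun hbot => ?_, fun U hU => ?_⟩⟩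
  · exact (isOpen_singleton_iff_punctured_nhds x).2 hx
  · exact Set.singleton_ne_empty x (congrArg SetLike.coe hbot)
  · exact SetLike.coe_injective (Set.ssubset_singleton_iff.1 hU)

attribute [local instance] booleanMVStructure

theorem coe_charFn_apply {U : Set X} (hU : IsClopen U) (x : X) [Decidable (x ∈ U)] :
    (LocallyConstant.charFn unitInterval hU x : ℝ) = if x ∈ U then 1 else 0 := by
  rw [LocallyConstant.coe_charFn, Set.indicator_apply, apply_ite Subtype.val]
  rfl

/-- The representation of the clopen subsets of `X` by their indicator functions. -/
noncomputable def clopensEmbedding (X : Type*) [TopologicalSpace X] :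
    Clopens X ↪[mvLang] (X → unitInterval) :=
  .ofInjective (f := mvHom (fun U => LocallyConstant.charFn unitInterval U.isClopen)
    (funext fun x => (LocallyConstant.charFn_eq_zero _ x _).2 (Set.notMem_empty x))
    (fun U => funext fun x => Subtype.ext <| by
      classical
      change (LocallyConstant.charFn unitInterval Uᶜ.isClopen x : ℝ) =
        1 - (LocallyConstant.charFn unitInterval U.isClopen x : ℝ)
      rw [coe_charFn_apply, coe_charFn_apply]
      by_cases hx : x ∈ (U : Set X) <;> simp [hx])
    fun U W => funext fun x => Subtype.ext <| by
      classical
      change (LocallyConstant.charFn unitInterval (U ⊔ W).isClopen x : ℝ) =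
        min ((LocallyConstant.charFn unitInterval U.isClopen x : ℝ) +
          (LocallyConstant.charFn unitInterval W.isClopen x : ℝ)) 1
      rw [coe_charFn_apply, coe_charFn_apply, coe_charFn_apply]
      by_cases hU : x ∈ (U : Set X) <;> by_cases hW : x ∈ (W : Set X) <;> simp [hU, hW])
  fun U W h => SetLike.coe_injective <|
    LocallyConstant.charFn_inj unitInterval U.isClopen W.isClopen (DFunLike.coe_injective h)

theorem clopensEmbedding_apply (U : Clopens X) :
    clopensEmbedding X U = LocallyConstant.charFn unitInterval U.isClopen := rfl

theorem isLocConstRep_clopensEmbedding : IsLocConstRep booleanUnit (clopensEmbedding X) := by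
  refine fun f => ⟨?_, fun ⟨hf, hf_val⟩ =>
    ⟨⟨f ⁻¹' {1}, hf.isClopen_fiber 1⟩, funext fun x => ?_⟩⟩
  · rintro ⟨U, rfl⟩
    rw [clopensEmbedding_apply]
    exact ⟨LocallyConstant.isLocallyConstant _, charFn_mem_booleanUnit U.isClopen⟩
  · rw [clopensEmbedding_apply]
    rcases hf_val x with hx | hx <;> rw [hx]
    · exact (LocallyConstant.charFn_eq_zero unitInterval x _).2 fun hx' =>
        zero_ne_one (hx.symm.trans hx')
    · exact (LocallyConstant.charFn_eq_one unitInterval x _).2 hx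

namespace IsLocConstRep

variable {B S : Type*} [BooleanAlgebra B] [Countable B] [Nontrivial B] [mvLang.Structure S]
  [Countable S] [CompactSpace X] [TotallySeparatedSpace X] [PerfectSpace X] [Nonempty X]
  {ι : S ↪[mvLang] (X → unitInterval)}

theorem nonempty_equiv_of_forall_not_isAtom (h : IsLocConstRep booleanUnit ι)
    (hB : ∀ b : B, ¬ IsAtom b) : Nonempty (S ≃[mvLang] B) := by
  let D := stoneOrderIso B
  have : Nontrivial (AsBoolRing B) := inferInstanceAs (Nontrivial B)
  have : PerfectSpace (PrimeSpectrum (AsBoolRing B)) :=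
    perfectSpace_of_forall_not_isAtom fun U hU => hB (D.symm U) ((D.symm.isAtom_iff U).2 hU)
  exact h.nonempty_equiv booleanUnit_subset_rationalUnit
    (isLocConstRep_clopensEmbedding.comp_equiv (mvEquivOfOrderIso D))

theorem exists_equiv_booleanAlgebra (h : IsLocConstRep booleanUnit ι)
    (hB : ∀ b : B, ¬ IsAtom b) :
    ∃ e : S ≃ B, e (mvZero S) = ⊥ ∧ (∀ x, e (mvNeg x) = (e x)ᶜ) ∧
      ∀ x y, e (mvAdd x y) = e x ⊔ e y := by
  obtain ⟨e⟩ := h.nonempty_equiv_of_forall_not_isAtom hB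
  exact ⟨e.toEquiv, map_mvZero e, map_mvNeg e, map_mvAdd e⟩

theorem nonempty_aut_mulEquiv_orderIso (h : IsLocConstRep booleanUnit ι)
    (hB : ∀ b : B, ¬ IsAtom b) : Nonempty ((S ≃[mvLang] S) ≃* (B ≃o B)) :=
  let ⟨e⟩ := h.nonempty_equiv_of_forall_not_isAtom hB
  ⟨(autCongr e).trans (autMulEquivOrderIso B)⟩

end IsLocConstRep

end StoneDuality

/-! ### The Cantor set -/

section CantorSpace

instance {α : Type*} [Infinite α] {Y : α → Type*} [∀ a, TopologicalSpace (Y a)]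
    [∀ a, Nontrivial (Y a)] : PerfectSpace (∀ a, Y a) := by
  classical
  refine perfectSpace_iff_forall_not_isolated.2 fun x => ⟨fun hx => ?_⟩
  obtain ⟨I, U, hU, hsub⟩ :=
    isOpen_pi_iff.1 ((isOpen_singleton_iff_punctured_nhds x).2 hx) x rfl
  obtain ⟨a, ha⟩ := Infinite.exists_notMem_finset I
  obtain ⟨y, hy⟩ := exists_ne (x a)
  have hupdate : Function.update x a y = x := hsub fun i hi => by
    rw [Function.update_of_ne (ne_of_mem_of_not_mem hi ha)]
    exact (hU i hi).2
  exact hy (Function.update_eq_self_iff.1 hupdate)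

theorem perfectSpace_of_homeomorph {X Y : Type*} [TopologicalSpace X] [TopologicalSpace Y]
    [PerfectSpace Y] (e : X ≃ₜ Y) : PerfectSpace X := by
  refine perfectSpace_iff_forall_not_isolated.2 fun x => ⟨fun hx => ?_⟩
  rw [← isOpen_singleton_iff_punctured_nhds, ← e.isOpen_image, Set.image_singleton,
    isOpen_singleton_iff_punctured_nhds] at hx
  exact (PerfectSpace.not_isolated (e x)).ne hx

instance : CompactSpace cantorSet := isCompact_iff_compactSpace.mp isCompact_cantorSet

instance : TotallyDisconnectedSpace cantorSet :=
  cantorSetHomeomorphNatToBool.symm.totallyDisconnectedSpace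

instance : PerfectSpace cantorSet := perfectSpace_of_homeomorph cantorSetHomeomorphNatToBool

instance : Nonempty cantorSet := ⟨⟨0, zero_mem_cantorSet⟩⟩

theorem isLocConstRep_cantorMV : IsLocConstRep rationalUnit cantorMV.subtype := fun f =>
  Iff.trans ⟨fun ⟨s, hs⟩ => hs ▸ s.2, fun hf => ⟨⟨f, hf⟩, rfl⟩⟩ (mem_rationalFuzzyClopens_iff f)

theorem exists_isLocConstRep_of_isFraisseLimit {M : Type u} [mvLang.Structure M] [Countable M]
    (h : IsFraisseLimit finiteMV.{u} M) :
    ∃ ι : M ↪[mvLang] (cantorSet → unitInterval), IsLocConstRep rationalUnit ι := by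
  -- Fraïssé limits are only compared within a universe, so `cantorMV` is lifted to that of `M`.
  let lift : cantorMV ≃ ULift.{u} cantorMV := Equiv.ulift.symm
  let _ : mvLang.Structure (ULift.{u} cantorMV) := lift.inducedStructure
  have hlift := isLocConstRep_cantorMV.comp_equiv (lift.inducedStructureEquiv (L := mvLang)).symm
  obtain ⟨e⟩ := h.nonempty_equiv hlift.isFraisseLimit
  exact ⟨_, hlift.comp_equiv e⟩

end CantorSpace

theorem corollary4p10 :
    IsFraisseLimit finiteMV.{0} cantorMV ∧
    (∃ Φ : (cantorSet ≃ₜ cantorSet) ≃* (cantorMV ≃[mvLang] cantorMV),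
      ∀ (h : cantorSet ≃ₜ cantorSet) (f : cantorMV) (x : cantorSet),
        (Φ h f : cantorSet → unitInterval) x = (f : cantorSet → unitInterval) (h.symm x)) ∧
    ∀ (M : Type u) [mvLang.Structure M] [Countable M], IsFraisseLimit finiteMV.{u} M →
      (∀ (B : Type v) [BooleanAlgebra B] [Countable B] [Nontrivial B], (∀ b : B, ¬ IsAtom b) →
        Nonempty ((M ≃[mvLang] M) ≃* (B ≃o B))) ∧
      ∃ hM : IsMVAlgebra M,
        (∃ R : (M ≃[mvLang] M) ≃* (booleanCenter hM ≃[mvLang] booleanCenter hM),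
          ∀ (σ : M ≃[mvLang] M) (b : booleanCenter hM), (R σ b : M) = σ b) ∧
        ∀ (B : Type v) [BooleanAlgebra B] [Countable B] [Nontrivial B], (∀ b : B, ¬ IsAtom b) →
          ∃ e : booleanCenter hM ≃ B, e (mvZero (booleanCenter hM)) = ⊥ ∧
            (∀ x, e (mvNeg x) = (e x)ᶜ) ∧ ∀ x y, e (mvAdd x y) = e x ⊔ e y := by
  refine ⟨isLocConstRep_cantorMV.isFraisseLimit,
    isLocConstRep_cantorMV.exists_homeomorph_mulEquiv booleanUnit_subset_rationalUnit, ?_⟩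
  intro M _ _ hlim
  obtain ⟨ι, h⟩ := exists_isLocConstRep_of_isFraisseLimit hlim
  have hM : IsMVAlgebra M := (isMVAlgebra_fuzzy _).of_injective ι ι.injective
  have hc := h.comp_booleanCenter_subtype booleanUnit_subset_rationalUnit hM
  obtain ⟨R, hR⟩ := h.exists_restrict_booleanCenter_mulEquiv booleanUnit_subset_rationalUnit hM
  refine ⟨fun B _ _ _ hB => ?_, hM, ⟨R, hR⟩, fun B _ _ _ hB => hc.exists_equiv_booleanAlgebra hB⟩
  obtain ⟨e⟩ := hc.nonempty_aut_mulEquiv_orderIso hB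
  exact ⟨R.trans e⟩
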